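/- Let $\Gamma$ be a finite, simple, connected graph with vertex set $V$, $n=|V|$, diameter $D\ge 1$, adjacency matrix $A$, and distance matrices $A_0,\dots,A_D$, where $(A_i)_{uv}=1$ if $\operatorname{dist}(u,v)=i$ and $(A_i)_{uv}=0$ otherwise. Let $\lambda_0>\lambda_1>\cdots>\lambda_d$ be the distinct eigenvalues of $A$, and let $\alpha$ be the positive eigenvector of $A$ for $\lambda_0$ with $\|\alpha\|^2=n$. Let $p_0,\dots,p_d$ (with $\deg p_i=i$) be the predistance polynomials, that is, the polynomials orthogonal with respect to $\langle p,q\rangle_\Gamma=\frac1n\operatorname{tr}(p(A)q(A))$ and normalized by $\langle p_i,p_i\rangle_\Gamma=p_i(\lambda_0)$, and put $p_{\ge D}=p_D+p_{D+1}+\cdots+p_d$. For a vertex $u$ let $\Gamma_i(u)$ be the set of vertices at distance $i$ from $u$; for $U\subseteq V$ let $\rho_U=\sum_{v\in U}\alpha_v e_v$, where $e_v$ is the coordinate vector of $v$; and let $$\delta^*_i=\frac1n\sum_{u\in V}\alpha_u^2\,\|\rho_{\Gamma_i(u)}\|^2 .$$ If $$\delta^*_D=p_{\ge D}(\lambda_0)\qquad\text{and}\qquad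 \delta^*_{D-1}=p_{D-1}(\lambda_0),$$ then $\Gamma$ is regular and $(D-1)$-partially distance-regular, i.e. $p_i(A)=A_i$ for every $0\le i\le D-1$. Moreover $\Gamma$ is distance-polynomial: each of $A_0,\dots,A_D$ is a polynomial in $A$ (with real coefficients). -/

import Mathlib

open Polynomial

namespace DistancePolynomial

variable {V : Type*} [Fintype V] [DecidableEq V] (G : SimpleGraph V) [DecidableRel G.Adj]

/-- The largest eigenvalue `λ₀` of the adjacency matrix. -/
noncomputable def lambda0 : ℝ := sSup (spectrum ℝ (G.adjMatrix ℝ))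

/-- The number `d`, where `d + 1` is the number of distinct eigenvalues. -/
noncomputable def dNum : ℕ := (spectrum ℝ (G.adjMatrix ℝ)).ncard - 1

/-- `α` is a positive eigenvector of `A` for the eigenvalue `λ₀`, with `‖α‖² = n`. -/
structure IsPerronVector (α : V → ℝ) : Prop where
  pos : ∀ u, 0 < α u
  eigen : (G.adjMatrix ℝ).mulVec α = lambda0 G • α
  norm_sq : ∑ u, α u ^ 2 = (Fintype.card V : ℝ)

theorem exists_eigenvector_lambda0 [Nonempty V] :
    ∃ x : V → ℝ, x ≠ 0 ∧ (G.adjMatrix ℝ).mulVec x = lambda0 G • x := by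
  have hA : (G.adjMatrix ℝ).IsHermitian := G.isHermitian_adjMatrix ℝ
  have hne : (spectrum ℝ (G.adjMatrix ℝ)).Nonempty := by
    rw [hA.spectrum_real_eq_range_eigenvalues]
    exact Set.range_nonempty _
  have hfin : (spectrum ℝ (G.adjMatrix ℝ)).Finite := by
    rw [hA.spectrum_real_eq_range_eigenvalues]
    exact Set.finite_range _
  have hmem : lambda0 G ∈ spectrum ℝ (G.adjMatrix ℝ) := hne.csSup_mem hfin
  rw [hA.spectrum_real_eq_range_eigenvalues] at hmem
  obtain ⟨i, hi⟩ := hmem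
  refine ⟨(hA.eigenvectorBasis i).ofLp, ?_, ?_⟩
  · intro h
    apply hA.eigenvectorBasis.orthonormal.ne_zero i
    ext v
    exact congrFun h v
  · rw [hA.mulVec_eigenvectorBasis i, hi]

theorem posSemidef_lambda0_sub : (lambda0 G • (1 : Matrix V V ℝ) - G.adjMatrix ℝ).PosSemidef := by
  have hA : (G.adjMatrix ℝ).IsHermitian := G.isHermitian_adjMatrix ℝ
  have hB : (lambda0 G • (1 : Matrix V V ℝ) - G.adjMatrix ℝ).IsHermitian := by
    refine Matrix.IsHermitian.sub ?_ hA
    ext i j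
    simp [Matrix.one_apply, eq_comm]
  have hfin : (spectrum ℝ (G.adjMatrix ℝ)).Finite := by
    rw [hA.spectrum_real_eq_range_eigenvalues]
    exact Set.finite_range _
  rw [hB.posSemidef_iff_eigenvalues_nonneg]
  intro i
  have h1 : hB.eigenvalues i ∈ spectrum ℝ (lambda0 G • (1 : Matrix V V ℝ) - G.adjMatrix ℝ) := by
    rw [hB.spectrum_real_eq_range_eigenvalues]
    exact ⟨i, rfl⟩
  generalize hB.eigenvalues i = t at h1
  rw [← Algebra.algebraMap_eq_smul_one, ← spectrum.singleton_sub_eq] at h1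
  obtain ⟨a, ha, b, hb, hab⟩ := h1
  have ha' : a = lambda0 G := ha
  have hle : b ≤ lambda0 G := le_csSup hfin.bddAbove hb
  have hab' : a - b = t := hab
  show (0 : ℝ) ≤ t
  linarith

/-- Every connected graph has a normalized Perron vector. -/
theorem exists_isPerronVector (hG : G.Connected) : ∃ α : V → ℝ, IsPerronVector G α := by
  have := hG.nonempty
  obtain ⟨x, hx0, hx⟩ := exists_eigenvector_lambda0 G
  have hpsd := posSemidef_lambda0_sub G
  have key : ∀ z : V → ℝ,
      star z ⬝ᵥ ((lambda0 G • (1 : Matrix V V ℝ) - G.adjMatrix ℝ).mulVec z)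
        = lambda0 G * ∑ u, z u * z u
          - ∑ u, ∑ v, z u * ((if G.Adj u v then (1 : ℝ) else 0) * z v) := by
    intro z
    rw [Matrix.sub_mulVec, Matrix.smul_mulVec, Matrix.one_mulVec, dotProduct_sub]
    simp only [dotProduct, Matrix.mulVec, star_trivial, Pi.smul_apply, smul_eq_mul,
      Finset.mul_sum, SimpleGraph.adjMatrix_apply]
    congr 1
    exact Finset.sum_congr rfl fun u _ => by ring
  have hx1 : star x ⬝ᵥ ((lambda0 G • (1 : Matrix V V ℝ) - G.adjMatrix ℝ).mulVec x) = 0 := by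
    rw [Matrix.sub_mulVec, Matrix.smul_mulVec, Matrix.one_mulVec, hx, sub_self, dotProduct_zero]
  set y : V → ℝ := fun u => |x u| with hy
  have hy1 : star y ⬝ᵥ ((lambda0 G • (1 : Matrix V V ℝ) - G.adjMatrix ℝ).mulVec y) = 0 := by
    refine le_antisymm ?_ (hpsd.dotProduct_mulVec_nonneg y)
    rw [← hx1, key, key]
    have e1 : ∑ u, y u * y u = ∑ u, x u * x u :=
      Finset.sum_congr rfl fun u _ => abs_mul_abs_self (x u)
    rw [e1]
    refine sub_le_sub_left (Finset.sum_le_sum fun u _ => Finset.sum_le_sum fun v _ => ?_) _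
    split_ifs
    · simp only [one_mul, hy, ← abs_mul]
      exact le_abs_self _
    · simp
  have hy2 : (G.adjMatrix ℝ).mulVec y = lambda0 G • y := by
    have h := (hpsd.dotProduct_mulVec_zero_iff y).1 hy1
    rw [Matrix.sub_mulVec, Matrix.smul_mulVec, Matrix.one_mulVec, sub_eq_zero] at h
    exact h.symm
  have hynn : ∀ u, 0 ≤ y u := fun u => abs_nonneg _
  have hstep : ∀ u v, G.Adj u v → y u = 0 → y v = 0 := by
    intro u v huv hu
    have h := congrFun hy2 u
    rw [SimpleGraph.adjMatrix_mulVec_apply, Pi.smul_apply, hu, smul_zero] at h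
    exact (Finset.sum_eq_zero_iff_of_nonneg fun w _ => hynn w).1 h v (by simpa using huv)
  have hwalk : ∀ u v, G.Walk u v → y u = 0 → y v = 0 := by
    intro u v w
    induction w with
    | nil => exact id
    | cons h _ ih => exact fun hu => ih (hstep _ _ h hu)
  have hypos : ∀ u, 0 < y u := by
    intro u
    refine lt_of_le_of_ne (hynn u) fun hu => hx0 ?_
    funext v
    obtain ⟨w⟩ := hG.preconnected u v
    exact abs_eq_zero.1 (hwalk u v w hu.symm)
  have hS : 0 < ∑ u, y u ^ 2 :=
    Finset.sum_pos (fun u _ => pow_pos (hypos u) 2) Finset.univ_nonempty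
  have hn : (0 : ℝ) < Fintype.card V := by exact_mod_cast Fintype.card_pos
  set c : ℝ := Real.sqrt ((Fintype.card V : ℝ) / ∑ u, y u ^ 2) with hc
  have hcpos : 0 < c := Real.sqrt_pos.2 (div_pos hn hS)
  refine ⟨c • y, fun u => mul_pos hcpos (hypos u), ?_, ?_⟩
  · rw [Matrix.mulVec_smul, hy2, smul_comm]
  · simp only [Pi.smul_apply, smul_eq_mul, mul_pow]
    rw [← Finset.mul_sum, hc, Real.sq_sqrt (div_pos hn hS).le, div_mul_cancel₀ _ hS.ne']

/-- The Perron vector `α` of a connected graph (the unique vector with `IsPerronVector`). -/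
noncomputable def perronVector (hG : G.Connected) : V → ℝ :=
  Classical.choose (exists_isPerronVector G hG)

/-- The scalar product `⟨p, q⟩_Γ = (1/n) tr (p(A) q(A))`. -/
noncomputable def polyInner (p q : ℝ[X]) : ℝ :=
  (1 / (Fintype.card V : ℝ)) * (aeval (G.adjMatrix ℝ) p * aeval (G.adjMatrix ℝ) q).trace

/-- The monic orthogonal polynomials `r₀, r₁, …` of `polyInner`: the Gram–Schmidt process applied
to `1, X, X², …`. They are meaningful for indices `k ≤ d`, where `polyInner` is definite. -/
noncomputable def monicOrtho (k : ℕ) : ℝ[X] :=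
  X ^ k - ∑ j : Fin k,
    C (polyInner G (X ^ k) (monicOrtho j.1) /
        polyInner G (monicOrtho j.1) (monicOrtho j.1)) * monicOrtho j.1
  termination_by k
  decreasing_by all_goals exact j.2

/-- The predistance polynomial `p_k` (`k ≤ d`): the multiple of `r_k` with
`‖p_k‖² = p_k(λ₀)`, that is `p_k = (r_k(λ₀) / ‖r_k‖²) r_k`. -/
noncomputable def predistPoly (k : ℕ) : ℝ[X] :=
  C ((monicOrtho G k).eval (lambda0 G) / polyInner G (monicOrtho G k) (monicOrtho G k)) *
    monicOrtho G k

/-- `p_{≥ j} = p_j + p_{j+1} + ⋯ + p_d`. -/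
noncomputable def predistPolyGE (j : ℕ) : ℝ[X] :=
  ∑ i ∈ Finset.Icc j (dNum G), predistPoly G i

/-- The set `Γ_i(u)` of vertices at distance `i` from `u`. -/
noncomputable def sphere (i : ℕ) (u : V) : Finset V := {v | G.dist u v = i}

/-- The distance matrix `A_i`. -/
noncomputable def distMatrix (i : ℕ) : Matrix V V ℝ :=
  Matrix.of fun u v => if G.dist u v = i then 1 else 0

/-- The vector `ρ_U = ∑_{v ∈ U} α_v e_v`. -/
noncomputable def rho (hG : G.Connected) (U : Finset V) : EuclideanSpace ℝ V :=
  ∑ v ∈ U, perronVector G hG v • EuclideanSpace.single v (1 : ℝ)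

/-- `δ*_i`, the arithmetic mean over the vertices `u` of the numbers `α_u² ‖ρ_{Γ_i(u)}‖²`. -/
noncomputable def deltaStar (hG : G.Connected) (i : ℕ) : ℝ :=
  (1 / (Fintype.card V : ℝ)) *
    ∑ u, perronVector G hG u ^ 2 * ‖rho G hG (sphere G i u)‖ ^ 2

/-- `m`-partial distance-regularity: `m ≤ D` and `p_i(A) = A_i` for all `i ≤ m`. -/
def IsPartiallyDistanceRegular (m : ℕ) : Prop :=
  m ≤ G.diam ∧ ∀ i ≤ m, aeval (G.adjMatrix ℝ) (predistPoly G i) = distMatrix G i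

/-- Every distance matrix `A_0, …, A_D` is a polynomial in the adjacency matrix. -/
def IsDistancePolynomial : Prop :=
  ∀ i ≤ G.diam, ∃ p : ℝ[X], aeval (G.adjMatrix ℝ) p = distMatrix G i

end DistancePolynomial

/-!
Write `W_i` for the matrix with entries `α_u α_v` at the pairs at distance `i`, so that
`∑ i, W_i = α αᵀ` and `δ*_i = (1/n) tr W_i²`. The predistance polynomials sum to the Hoffman
polynomial, `(p_0 + ⋯ + p_d)(A) = α αᵀ`. A polynomial of degree less than `i` contributes nothing at
distance `i`, so `p_{≥ D}(A)` agrees with `W_D` on the support of `W_D`; as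
`‖p_{≥ D}‖² = p_{≥ D}(λ₀)`, the first hypothesis says that both matrices have the same norm, hence
they coincide. Removing `W_D`, the same argument applied to the second hypothesis gives
`p_{D-1}(A) = W_{D-1}`. The Christoffel–Darboux formula at `λ₀` carries the equality down to
`p_0(A) = W_0`, that is `1 = diag (α_u²)`; therefore `α = 1`, the graph is regular, and
`W_i = A_i` for every `i`.
-/

namespace DistancePolynomial

/-! ### Matrices and polynomials -/

theorem isSelfAdjoint_aeval {R A : Type*} [CommSemiring R] [StarRing R] [TrivialStar R]
    [Semiring A] [StarRing A] [Algebra R A] [StarModule R A] {a : A} (ha : IsSelfAdjoint a)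
    (p : R[X]) : IsSelfAdjoint (aeval a p) := by
  rw [aeval_eq_sum_range]
  exact isSelfAdjoint_sum _ fun i _ => (IsSelfAdjoint.all _).smul (ha.pow i)

theorem eval_eq_zero_of_aeval_eq_zero {K A : Type*} [Field K] [Ring A] [Algebra K A] {a : A}
    {p : K[X]} (hp : aeval a p = 0) {μ : K} (hμ : μ ∈ spectrum K a) : p.eval μ = 0 := by
  have : Nontrivial A := not_subsingleton_iff_nontrivial.1 fun _ => hμ (isUnit_of_subsingleton _)
  have hmem : p.eval μ ∈ spectrum K (aeval a p) :=
    spectrum.subset_polynomial_aeval a p (Set.mem_image_of_mem _ hμ)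
  rwa [hp, spectrum.zero_eq, Set.mem_singleton_iff] at hmem

theorem exists_monic_natDegree_eq_aeval_eq_zero {𝕜 n : Type*} [RCLike 𝕜] [Fintype n]
    [DecidableEq n] {A : Matrix n n 𝕜} (hA : A.IsHermitian) :
    ∃ m : ℝ[X], m.Monic ∧ m.natDegree = (spectrum ℝ A).ncard ∧ aeval A m = 0 := by
  have hfin : (spectrum ℝ A).Finite := A.finite_real_spectrum
  refine ⟨∏ μ ∈ hfin.toFinset, (X - C μ), monic_prod_X_sub_C _ _, ?_, ?_⟩
  · rw [natDegree_finsetProd_X_sub_C_eq_card, Set.ncard_eq_toFinset_card _ hfin]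
  · rw [← cfc_polynomial _ A hA.isSelfAdjoint, ← cfc_const_zero ℝ A]
    refine cfc_congr fun μ hμ => ?_
    simp only [eval_prod, eval_sub, eval_X, eval_C]
    exact Finset.prod_eq_zero (hfin.mem_toFinset.2 hμ) (sub_self μ)

theorem eq_of_trace_conjTranspose_mul_self_eq {R m n : Type*} [Fintype m] [Fintype n]
    [PartialOrder R] [NonUnitalRing R] [StarRing R] [StarOrderedRing R] [NoZeroDivisors R]
    {M W : Matrix m n R} (hMW : ∀ i j, W i j ≠ 0 → M i j = W i j)
    (htrace : (M.conjTranspose * M).trace = (W.conjTranspose * W).trace) : M = W := by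
  have hleft : (W.conjTranspose * M).trace = (W.conjTranspose * W).trace := by
    simp only [Matrix.trace, Matrix.diag_apply, Matrix.mul_apply, Matrix.conjTranspose_apply]
    refine Finset.sum_congr rfl fun j _ => Finset.sum_congr rfl fun i _ => ?_
    by_cases h : W i j = 0
    · simp [h]
    · rw [hMW i j h]
  have hright : (M.conjTranspose * W).trace = (W.conjTranspose * W).trace := by
    have hstar := congrArg star hleft
    rwa [← Matrix.trace_conjTranspose, ← Matrix.trace_conjTranspose, Matrix.conjTranspose_mul,
      Matrix.conjTranspose_mul, Matrix.conjTranspose_conjTranspose] at hstar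
  rw [← sub_eq_zero, ← Matrix.trace_conjTranspose_mul_self_eq_zero_iff, Matrix.conjTranspose_sub,
    Matrix.sub_mul, Matrix.mul_sub, Matrix.mul_sub, Matrix.trace_sub, Matrix.trace_sub,
    Matrix.trace_sub, htrace, hleft, hright, sub_self]

theorem eq_vecMulVec_of_isSymm {K n : Type*} [Field K] [Fintype n] {M : Matrix n n K}
    (hM : M.IsSymm) {x : n → K} (hx : x ⬝ᵥ x ≠ 0) (hcol : ∀ j, ∃ c : K, M.col j = c • x)
    (htrace : M.trace = x ⬝ᵥ x) : M = Matrix.vecMulVec x x := by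
  choose c hc using hcol
  have hMc : ∀ i j, M i j = c j * x i := fun i j => congrFun (hc j) i
  have hcx : ∀ j, c j = x j := fun j => mul_right_cancel₀ hx <| calc
    c j * (x ⬝ᵥ x) = ∑ i, M i j * x i := by
      simp only [dotProduct, Finset.mul_sum, hMc, mul_assoc]
    _ = ∑ i, M j i * x i := by simp only [hM.apply]
    _ = x j * M.trace := by
      simp only [Matrix.trace, Matrix.diag_apply, Finset.mul_sum, hMc]
      exact Finset.sum_congr rfl fun i _ => by ring
    _ = x j * (x ⬝ᵥ x) := by rw [htrace]
  ext i j
  rw [hMc, hcx, Matrix.vecMulVec_apply, mul_comm]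

theorem card_ne_zero {V : Type*} [Fintype V] [Nonempty V] : (Fintype.card V : ℝ) ≠ 0 :=
  Nat.cast_ne_zero.2 Fintype.card_ne_zero

theorem degree_X_sub_C_mul_lt {R : Type*} [Ring R] (c : R) {p : R[X]} {m : ℕ}
    (hp : p.degree < m) : ((X - C c) * p).degree < ((m + 1 : ℕ) : WithBot ℕ) := by
  rw [degree_lt_iff_coeff_zero] at hp ⊢
  intro k hk
  obtain ⟨k, rfl⟩ := Nat.exists_eq_add_of_le' (Nat.one_le_of_lt hk)
  rw [sub_mul, coeff_sub, coeff_X_mul, coeff_C_mul, hp k (by omega), hp (k + 1) (by omega),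
    mul_zero, sub_zero]

theorem linearMap_eq_of_degree_lt {K M : Type*} [Field K] [AddCommGroup M] [Module K M]
    (S : Polynomial.Sequence K) {f g : K[X] →ₗ[K] M} {m : ℕ} (hfg : ∀ i < m, f (S i) = g (S i))
    {p : K[X]} (hp : p.degree < m) : f p = g p := by
  refine LinearMap.eqOn_span (s := S '' Set.Iio m) (Set.forall_mem_image.2 fun i hi => hfg i hi) ?_
  rw [S.span_degreeLT fun i _ => (leadingCoeff_ne_zero.2 (S.ne_zero i)).isUnit]
  exact mem_degreeLT.2 hp

/-! ### Distances and weighted distance matrices -/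

section

variable {V : Type*} {G : SimpleGraph V}

theorem exists_dist_eq_of_le_diam (hG : G.Connected) {j : ℕ} (hj : j ≤ G.diam) :
    ∃ u v, G.dist u v = j := by
  have := hG.nonempty
  obtain ⟨u, v, huv⟩ := G.exists_dist_eq_diam
  obtain ⟨w, hw⟩ := hG.exists_walk_length_eq_dist u v
  have htake := SimpleGraph.dist_le (w.take j)
  have hdrop := SimpleGraph.dist_le (w.drop j)
  have htri := hG.dist_triangle (u := u) (v := w.getVert j) (w := v)
  rw [SimpleGraph.Walk.take_length] at htake
  rw [SimpleGraph.Walk.drop_length] at hdrop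
  exact ⟨u, w.getVert j, by omega⟩

variable (G) in
/-- The weighted distance matrix: its entry is `α_u α_v` where `dist(u, v) = i`, and `0` elsewhere.
For the Perron vector `α`, its mean square is the number `δ*_i`. -/
noncomputable def weightedDistMatrix (α : V → ℝ) (i : ℕ) : Matrix V V ℝ :=
  Matrix.of fun u v => if G.dist u v = i then α u * α v else 0

theorem weightedDistMatrix_apply (α : V → ℝ) (i : ℕ) (u v : V) :
    weightedDistMatrix G α i u v = if G.dist u v = i then α u * α v else 0 := rfl

theorem sum_weightedDistMatrix_apply (α : V → ℝ) (m : ℕ) (u v : V) :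
    (∑ i ∈ Finset.range m, weightedDistMatrix G α i) u v =
      if G.dist u v < m then α u * α v else 0 := by
  simp [Matrix.sum_apply, weightedDistMatrix_apply]

theorem isHermitian_weightedDistMatrix (α : V → ℝ) (i : ℕ) :
    (weightedDistMatrix G α i).IsHermitian :=
  Matrix.IsHermitian.ext fun u v => by
    simp only [weightedDistMatrix_apply, star_trivial, G.dist_comm, mul_comm]

theorem weightedDistMatrix_one (i : ℕ) : weightedDistMatrix G 1 i = distMatrix G i := by
  ext u v
  simp [weightedDistMatrix_apply, distMatrix]

theorem distMatrix_zero [DecidableEq V] (hG : G.Connected) : distMatrix G 0 = 1 := by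
  ext u v
  simp [distMatrix, Matrix.one_apply, hG.dist_eq_zero_iff]

theorem dist_le_diam [Finite V] (hG : G.Connected) (u v : V) : G.dist u v ≤ G.diam :=
  have := hG.nonempty
  SimpleGraph.dist_le_diam (SimpleGraph.connected_iff_ediam_ne_top.1 hG)

theorem sum_weightedDistMatrix_diam [Finite V] (hG : G.Connected) (α : V → ℝ) :
    ∑ i ∈ Finset.range (G.diam + 1), weightedDistMatrix G α i = Matrix.vecMulVec α α := by
  ext u v
  rw [sum_weightedDistMatrix_apply, if_pos (Nat.lt_succ_of_le (dist_le_diam hG u v)),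
    Matrix.vecMulVec_apply]

theorem aeval_adjMatrix_apply_eq_zero_of_degree_lt {R : Type*} [CommSemiring R] [Fintype V]
    [DecidableEq V] [DecidableRel G.Adj] {p : R[X]} {u v : V} (hp : p.degree < G.dist u v) :
    aeval (G.adjMatrix R) p u v = 0 := by
  rw [aeval_eq_sum_range, Matrix.sum_apply]
  refine Finset.sum_eq_zero fun i _ => ?_
  rw [Matrix.smul_apply, smul_eq_mul]
  by_cases hi : G.dist u v ≤ i
  · rw [(degree_lt_iff_coeff_zero _ _).1 hp i hi, zero_mul]
  · have : IsEmpty {w : G.Walk u v | w.length = i} :=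
      ⟨fun w => hi (w.2 ▸ SimpleGraph.dist_le w.1)⟩
    rw [SimpleGraph.adjMatrix_pow_apply_eq_card_walk, Fintype.card_eq_zero, Nat.cast_zero,
      mul_zero]

theorem eq_zero_of_adjMatrix_mulVec_eq_smul {R : Type*} [Semiring R] [PartialOrder R]
    [IsOrderedAddMonoid R] [Fintype V] [DecidableRel G.Adj] (hG : G.Preconnected) {μ : R}
    {y : V → R} (hy : (G.adjMatrix R).mulVec y = μ • y) (hnonneg : 0 ≤ y) {u : V} (hu : y u = 0) :
    y = 0 := by
  have hwalk : ∀ {a b : V}, G.Walk a b → y a = 0 → y b = 0 := by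
    intro a b w
    induction w with
    | nil => exact id
    | @cons a c _ hac _ ih =>
      intro ha
      have hsum := congrFun hy a
      rw [SimpleGraph.adjMatrix_mulVec_apply, Pi.smul_apply, ha, smul_zero] at hsum
      exact ih ((Finset.sum_eq_zero_iff_of_nonneg fun x _ => hnonneg x).1 hsum c (by simpa))
  funext v
  obtain ⟨w⟩ := hG u v
  exact hwalk w hu

end

variable {V : Type*} [Fintype V] [DecidableEq V] (G : SimpleGraph V) [DecidableRel G.Adj]

/-! ### The scalar product of polynomials -/

theorem isHermitian_aeval_adjMatrix (p : ℝ[X]) : (aeval (G.adjMatrix ℝ) p).IsHermitian :=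
  isSelfAdjoint_aeval (G.isHermitian_adjMatrix ℝ).isSelfAdjoint p

theorem lambda0_mem_spectrum [Nonempty V] : lambda0 G ∈ spectrum ℝ (G.adjMatrix ℝ) := by
  refine Set.Nonempty.csSup_mem ?_ (G.adjMatrix ℝ).finite_real_spectrum
  rw [(G.isHermitian_adjMatrix ℝ).spectrum_real_eq_range_eigenvalues]
  exact Set.range_nonempty _

theorem ncard_spectrum [Nonempty V] : (spectrum ℝ (G.adjMatrix ℝ)).ncard = dNum G + 1 :=
  (Nat.sub_add_cancel <|
    (Set.ncard_pos (G.adjMatrix ℝ).finite_real_spectrum).2 ⟨_, lambda0_mem_spectrum G⟩).symm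

theorem eq_zero_of_aeval_adjMatrix_eq_zero [Nonempty V] {p : ℝ[X]}
    (hdeg : p.degree < ((dNum G + 1 : ℕ) : WithBot ℕ)) (hp : aeval (G.adjMatrix ℝ) p = 0) :
    p = 0 := by
  have hfin := (G.adjMatrix ℝ).finite_real_spectrum
  refine eq_zero_of_degree_lt_of_eval_finset_eq_zero hfin.toFinset ?_ fun μ hμ =>
    eval_eq_zero_of_aeval_eq_zero hp (hfin.mem_toFinset.1 hμ)
  rwa [← Set.ncard_eq_toFinset_card _ hfin, ncard_spectrum]

/-- The scalar product `⟨p, q⟩_Γ` as a bilinear form. -/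
noncomputable def polyForm : LinearMap.BilinForm ℝ ℝ[X] :=
  LinearMap.mk₂ ℝ (polyInner G)
    (fun _ _ _ => by simp only [polyInner, map_add, add_mul, Matrix.trace_add, mul_add])
    (fun _ _ _ => by
      simp only [polyInner, map_smul, smul_mul_assoc, Matrix.trace_smul, smul_eq_mul]; ring)
    (fun _ _ _ => by simp only [polyInner, map_add, mul_add, Matrix.trace_add])
    (fun _ _ _ => by
      simp only [polyInner, map_smul, mul_smul_comm, Matrix.trace_smul, smul_eq_mul]; ring)

theorem polyForm_apply (p q : ℝ[X]) : polyForm G p q = polyInner G p q := rfl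

theorem polyForm_comm (p q : ℝ[X]) : polyForm G p q = polyForm G q p := by
  rw [polyForm_apply, polyForm_apply, polyInner, polyInner, Matrix.trace_mul_comm]

theorem polyForm_mul_left (p q r : ℝ[X]) : polyForm G (p * q) r = polyForm G q (p * r) := by
  simp only [polyForm_apply, polyInner, ← map_mul]
  rw [mul_left_comm, mul_assoc]

theorem polyForm_one_one [Nonempty V] : polyForm G 1 1 = 1 := by
  simp [polyForm_apply, polyInner]

theorem card_mul_polyForm [Nonempty V] (p q : ℝ[X]) :
    Fintype.card V * polyForm G p q =
      (aeval (G.adjMatrix ℝ) p * aeval (G.adjMatrix ℝ) q).trace := by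
  rw [polyForm_apply, polyInner, ← mul_assoc, mul_one_div_cancel card_ne_zero, one_mul]

theorem polyForm_self_eq_zero_iff [Nonempty V] {p : ℝ[X]} :
    polyForm G p p = 0 ↔ aeval (G.adjMatrix ℝ) p = 0 := by
  rw [← Matrix.trace_conjTranspose_mul_self_eq_zero_iff, (isHermitian_aeval_adjMatrix G p).eq,
    ← card_mul_polyForm, mul_eq_zero, or_iff_right card_ne_zero]

/-! ### The monic orthogonal polynomials -/

theorem monicOrtho_eq (k : ℕ) : monicOrtho G k = X ^ k - ∑ i ∈ Finset.range k,
    (polyForm G (X ^ k) (monicOrtho G i) / polyForm G (monicOrtho G i) (monicOrtho G i)) •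
      monicOrtho G i := by
  rw [monicOrtho.eq_def, Finset.sum_range]
  simp only [smul_eq_C_mul, polyForm_apply]

theorem monic_and_degree_monicOrtho (k : ℕ) :
    (monicOrtho G k).Monic ∧ (monicOrtho G k).degree = (k : WithBot ℕ) := by
  induction k using Nat.strong_induction_on with
  | _ k ih =>
    set q := ∑ i ∈ Finset.range k,
      (polyForm G (X ^ k) (monicOrtho G i) / polyForm G (monicOrtho G i) (monicOrtho G i)) •
        monicOrtho G i with hq
    have hlt : q.degree < (k : WithBot ℕ) := by
      rw [← mem_degreeLT, hq]
      refine Submodule.sum_mem _ fun i hi => Submodule.smul_mem _ _ (mem_degreeLT.2 ?_)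
      rw [Finset.mem_range] at hi
      exact (ih i hi).2 ▸ Nat.cast_lt.2 hi
    rw [monicOrtho_eq, ← hq]
    refine ⟨monic_X_pow_sub hlt, ?_⟩
    rw [degree_sub_eq_left_of_degree_lt (by rwa [degree_X_pow]), degree_X_pow]

theorem monic_monicOrtho (k : ℕ) : (monicOrtho G k).Monic := (monic_and_degree_monicOrtho G k).1

theorem degree_monicOrtho (k : ℕ) : (monicOrtho G k).degree = (k : WithBot ℕ) :=
  (monic_and_degree_monicOrtho G k).2

/-- The monic orthogonal polynomials as a polynomial sequence, which gives access to the fact that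
the first `m` of them span the polynomials of degree less than `m`. -/
noncomputable def monicOrthoSequence : Polynomial.Sequence ℝ :=
  ⟨monicOrtho G, degree_monicOrtho G⟩

theorem monicOrtho_zero : monicOrtho G 0 = 1 := by
  rw [monicOrtho_eq, Finset.range_zero, Finset.sum_empty, pow_zero, sub_zero]

theorem polyForm_monicOrtho_self_ne_zero [Nonempty V] {k : ℕ} (hk : k ≤ dNum G) :
    polyForm G (monicOrtho G k) (monicOrtho G k) ≠ 0 := fun h =>
  (monic_monicOrtho G k).ne_zero <| eq_zero_of_aeval_adjMatrix_eq_zero G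
    (degree_monicOrtho G k ▸ Nat.cast_lt.2 (Nat.lt_succ_of_le hk))
    ((polyForm_self_eq_zero_iff G).1 h)

theorem polyForm_monicOrtho_of_lt [Nonempty V] {j k : ℕ} (hjk : j < k) (hk : k ≤ dNum G + 1) :
    polyForm G (monicOrtho G k) (monicOrtho G j) = 0 := by
  induction k using Nat.strong_induction_on generalizing j with
  | _ k ih =>
    have horth : ∀ i < k, i ≠ j → polyForm G (monicOrtho G i) (monicOrtho G j) = 0 := by
      intro i hi hij
      rcases hij.lt_or_gt with h | h
      · rw [polyForm_comm, ih j hjk h (by omega)]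
      · exact ih i hi h (by omega)
    rw [monicOrtho_eq G k, map_sub, map_sum, LinearMap.sub_apply, LinearMap.sum_apply,
      Finset.sum_eq_single_of_mem j (Finset.mem_range.2 hjk), map_smul, LinearMap.smul_apply,
      smul_eq_mul, div_mul_cancel₀ _ (polyForm_monicOrtho_self_ne_zero G (by omega)), sub_self]
    intro i hi hij
    rw [map_smul, LinearMap.smul_apply, horth i (Finset.mem_range.1 hi) hij, smul_zero]

theorem polyForm_monicOrtho_of_ne [Nonempty V] {j k : ℕ} (hjk : j ≠ k) (hj : j ≤ dNum G + 1)
    (hk : k ≤ dNum G + 1) : polyForm G (monicOrtho G j) (monicOrtho G k) = 0 := by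
  rcases hjk.lt_or_gt with h | h
  · rw [polyForm_comm, polyForm_monicOrtho_of_lt G h hk]
  · exact polyForm_monicOrtho_of_lt G h hj

theorem polyForm_monicOrtho_of_degree_lt [Nonempty V] {k : ℕ} (hk : k ≤ dNum G + 1) {q : ℝ[X]}
    (hq : q.degree < (k : WithBot ℕ)) : polyForm G (monicOrtho G k) q = 0 :=
  linearMap_eq_of_degree_lt (monicOrthoSequence G) (g := 0)
    (fun _ hi => polyForm_monicOrtho_of_lt G hi hk) hq

theorem eq_zero_of_polyForm_monicOrtho_eq_zero [Nonempty V] {m : ℕ} (hm : m ≤ dNum G + 1)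
    {q : ℝ[X]} (hq : q.degree < (m : WithBot ℕ))
    (horth : ∀ i < m, polyForm G q (monicOrtho G i) = 0) : q = 0 := by
  refine eq_zero_of_aeval_adjMatrix_eq_zero G (hq.trans_le (Nat.cast_le.2 hm)) ?_
  rw [← polyForm_self_eq_zero_iff]
  exact linearMap_eq_of_degree_lt (monicOrthoSequence G) (g := 0) horth hq

/-- `r_{d+1}` is the minimal polynomial of `A`. -/
theorem aeval_monicOrtho_dNum_succ [Nonempty V] :
    aeval (G.adjMatrix ℝ) (monicOrtho G (dNum G + 1)) = 0 := by
  obtain ⟨m, hmonic, hdeg, hm⟩ :=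
    exists_monic_natDegree_eq_aeval_eq_zero (G.isHermitian_adjMatrix ℝ)
  set r := monicOrtho G (dNum G + 1)
  have hrdeg : r.degree = ((dNum G + 1 : ℕ) : WithBot ℕ) := degree_monicOrtho G _
  have hlt : (r - m).degree < ((dNum G + 1 : ℕ) : WithBot ℕ) := by
    rw [← hrdeg]
    refine degree_sub_lt_left ?_ (monic_monicOrtho G _).ne_zero ?_
    · rw [hrdeg, degree_eq_natDegree hmonic.ne_zero, hdeg, ncard_spectrum]
    · rw [(monic_monicOrtho G _).leadingCoeff, hmonic.leadingCoeff]
  have hpair : aeval (G.adjMatrix ℝ) (r - m) = aeval (G.adjMatrix ℝ) r := by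
    rw [map_sub, hm, sub_zero]
  rw [← polyForm_self_eq_zero_iff, ← polyForm_monicOrtho_of_degree_lt G le_rfl hlt, polyForm_apply,
    polyForm_apply, polyInner, polyInner, hpair]

theorem eval_lambda0_monicOrtho_dNum_succ [Nonempty V] :
    (monicOrtho G (dNum G + 1)).eval (lambda0 G) = 0 :=
  eval_eq_zero_of_aeval_eq_zero (aeval_monicOrtho_dNum_succ G) (lambda0_mem_spectrum G)

/-! ### Predistance polynomials -/

theorem predistPoly_eq_smul (k : ℕ) : predistPoly G k =
    ((monicOrtho G k).eval (lambda0 G) / polyForm G (monicOrtho G k) (monicOrtho G k)) •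
      monicOrtho G k := by
  rw [predistPoly, smul_eq_C_mul, polyForm_apply]

theorem degree_predistPoly_le (k : ℕ) : (predistPoly G k).degree ≤ (k : WithBot ℕ) := by
  rw [predistPoly_eq_smul, ← degree_monicOrtho G k]
  exact degree_smul_le _ _

theorem predistPoly_zero [Nonempty V] : predistPoly G 0 = 1 := by
  simp [predistPoly_eq_smul, monicOrtho_zero, polyForm_one_one]

theorem polyForm_monicOrtho_self_smul_predistPoly [Nonempty V] {k : ℕ} (hk : k ≤ dNum G) :
    polyForm G (monicOrtho G k) (monicOrtho G k) • predistPoly G k =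
      (monicOrtho G k).eval (lambda0 G) • monicOrtho G k := by
  rw [predistPoly_eq_smul, smul_smul, mul_div_cancel₀ _ (polyForm_monicOrtho_self_ne_zero G hk)]

theorem polyForm_predistPoly_monicOrtho [Nonempty V] {j k : ℕ} (hj : j ≤ dNum G)
    (hk : k ≤ dNum G) : polyForm G (predistPoly G j) (monicOrtho G k) =
      if j = k then (monicOrtho G k).eval (lambda0 G) else 0 := by
  rw [predistPoly_eq_smul, map_smul, LinearMap.smul_apply, smul_eq_mul]
  split_ifs with hjk
  · rw [hjk, div_mul_cancel₀ _ (polyForm_monicOrtho_self_ne_zero G hk)]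
  · rw [polyForm_monicOrtho_of_ne G hjk (by omega) (by omega), mul_zero]

theorem polyForm_predistPoly [Nonempty V] {j k : ℕ} (hj : j ≤ dNum G) (hk : k ≤ dNum G) :
    polyForm G (predistPoly G j) (predistPoly G k) =
      if j = k then (predistPoly G k).eval (lambda0 G) else 0 := by
  rw [predistPoly_eq_smul G k, map_smul, polyForm_predistPoly_monicOrtho G hj hk, eval_smul,
    smul_ite, smul_zero]

theorem polyForm_sum_predistPoly_self [Nonempty V] {s : Finset ℕ} (hs : ∀ i ∈ s, i ≤ dNum G) :
    polyForm G (∑ i ∈ s, predistPoly G i) (∑ i ∈ s, predistPoly G i) =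
      (∑ i ∈ s, predistPoly G i).eval (lambda0 G) := by
  rw [map_sum (polyForm G _), eval_finsetSum]
  refine Finset.sum_congr rfl fun k hk => ?_
  rw [map_sum, LinearMap.sum_apply, Finset.sum_eq_single_of_mem k hk,
    polyForm_predistPoly G (hs k hk) (hs k hk), if_pos rfl]
  intro j hj hjk
  rw [polyForm_predistPoly G (hs j hj) (hs k hk), if_neg hjk]

/-- The sum `p_0 + ⋯ + p_{m-1}`, complementary to `p_{≥ m}`. It is the Christoffel–Darboux kernel
of the scalar product at `λ₀`. -/
noncomputable def predistPolyLT (m : ℕ) : ℝ[X] := ∑ i ∈ Finset.range m, predistPoly G i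

theorem predistPolyLT_succ (m : ℕ) :
    predistPolyLT G (m + 1) = predistPolyLT G m + predistPoly G m :=
  Finset.sum_range_succ _ _

theorem predistPolyLT_add_predistPolyGE {m : ℕ} (hm : m ≤ dNum G + 1) :
    predistPolyLT G m + predistPolyGE G m = predistPolyLT G (dNum G + 1) := by
  rw [predistPolyLT, predistPolyGE, predistPolyLT, ← Finset.Ico_succ_right_eq_Icc]
  exact Finset.sum_range_add_sum_Ico _ hm

theorem degree_predistPolyLT_lt (m : ℕ) : (predistPolyLT G m).degree < (m : WithBot ℕ) := by
  rw [← mem_degreeLT, predistPolyLT]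
  exact Submodule.sum_mem _ fun i hi => mem_degreeLT.2 <|
    (degree_predistPoly_le G i).trans_lt (Nat.cast_lt.2 (Finset.mem_range.1 hi))

theorem polyForm_predistPolyLT [Nonempty V] {m : ℕ} (hm : m ≤ dNum G + 1) {q : ℝ[X]}
    (hq : q.degree < (m : WithBot ℕ)) :
    polyForm G (predistPolyLT G m) q = q.eval (lambda0 G) := by
  refine linearMap_eq_of_degree_lt (monicOrthoSequence G) (g := leval (lambda0 G)) ?_ hq
  intro k hk
  change polyForm G (predistPolyLT G m) (monicOrtho G k) = (monicOrtho G k).eval (lambda0 G)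
  rw [predistPolyLT, map_sum, LinearMap.sum_apply,
    Finset.sum_eq_single_of_mem k (Finset.mem_range.2 hk),
    polyForm_predistPoly_monicOrtho G (by omega) (by omega), if_pos rfl]
  intro j hj hjk
  rw [Finset.mem_range] at hj
  rw [polyForm_predistPoly_monicOrtho G (by omega) (by omega), if_neg hjk]

/-! ### The Christoffel–Darboux formula -/

theorem degree_X_sub_C_mul_monicOrtho_sub_lt (c : ℝ) (j : ℕ) :
    ((X - C c) * monicOrtho G j - monicOrtho G (j + 1)).degree <
      ((j + 1 : ℕ) : WithBot ℕ) := by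
  have hmonic := (monic_X_sub_C c).mul (monic_monicOrtho G j)
  have hdeg : ((X - C c) * monicOrtho G j).degree = ((j + 1 : ℕ) : WithBot ℕ) := by
    rw [degree_mul, degree_X_sub_C, degree_monicOrtho, add_comm, Nat.cast_succ]
  conv_rhs => rw [← hdeg]
  refine degree_sub_lt_left ?_ hmonic.ne_zero ?_
  · rw [hdeg, degree_monicOrtho]
  · rw [hmonic.leadingCoeff, (monic_monicOrtho G _).leadingCoeff]

theorem polyForm_X_sub_C_mul_predistPolyLT [Nonempty V] {m : ℕ} (hm : m ≤ dNum G) {q : ℝ[X]}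
    (hq : q.degree < (m : WithBot ℕ)) :
    polyForm G ((X - C (lambda0 G)) * predistPolyLT G (m + 1)) q = 0 := by
  rw [polyForm_mul_left,
    polyForm_predistPolyLT G (Nat.succ_le_succ hm) (degree_X_sub_C_mul_lt _ hq), eval_mul, eval_sub,
    eval_X, eval_C, sub_self, zero_mul]

theorem polyForm_X_sub_C_mul_predistPolyLT_monicOrtho [Nonempty V] {j : ℕ} (hj : j ≤ dNum G) :
    polyForm G ((X - C (lambda0 G)) * predistPolyLT G (j + 1)) (monicOrtho G j) =
      -(monicOrtho G (j + 1)).eval (lambda0 G) := by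
  have horth : polyForm G (predistPolyLT G (j + 1)) (monicOrtho G (j + 1)) = 0 := by
    rw [polyForm_comm, polyForm_monicOrtho_of_degree_lt G (Nat.succ_le_succ hj)
      (degree_predistPolyLT_lt G _)]
  have hrem := polyForm_predistPolyLT G (Nat.succ_le_succ hj)
    (degree_X_sub_C_mul_monicOrtho_sub_lt G (lambda0 G) j)
  rwa [map_sub, horth, sub_zero, ← polyForm_mul_left, eval_sub, eval_mul, eval_sub, eval_X, eval_C,
    sub_self, zero_mul, zero_sub] at hrem

theorem christoffelDarboux_monicOrtho [Nonempty V] {j : ℕ} (hj : j ≤ dNum G) :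
    polyForm G (monicOrtho G j) (monicOrtho G j) •
        ((X - C (lambda0 G)) * predistPolyLT G (j + 1)) =
      (monicOrtho G j).eval (lambda0 G) • monicOrtho G (j + 1) -
        (monicOrtho G (j + 1)).eval (lambda0 G) • monicOrtho G j := by
  set N := polyForm G (monicOrtho G j) (monicOrtho G j)
  set a := (monicOrtho G j).eval (lambda0 G)
  set b := (monicOrtho G (j + 1)).eval (lambda0 G)
  set L := X - C (lambda0 G)
  -- In this form every summand visibly has degree at most `j`.
  have hsplit : N • (L * predistPolyLT G (j + 1)) -
        (a • monicOrtho G (j + 1) - b • monicOrtho G j) =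
      N • (L * predistPolyLT G j) + a • (L * monicOrtho G j - monicOrtho G (j + 1)) +
        b • monicOrtho G j := by
    have hsmul : N • (L * predistPoly G j) = a • (L * monicOrtho G j) := by
      rw [← mul_smul_comm, polyForm_monicOrtho_self_smul_predistPoly G hj, mul_smul_comm]
    rw [predistPolyLT_succ, mul_add, smul_add, hsmul, smul_sub]
    abel
  refine sub_eq_zero.1 <| eq_zero_of_polyForm_monicOrtho_eq_zero G (Nat.succ_le_succ hj) ?_ ?_
  · rw [hsplit, ← mem_degreeLT]
    refine add_mem (add_mem ?_ ?_) ?_ <;> refine Submodule.smul_mem _ _ (mem_degreeLT.2 ?_)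
    · exact degree_X_sub_C_mul_lt _ (degree_predistPolyLT_lt G j)
    · exact degree_X_sub_C_mul_monicOrtho_sub_lt G _ j
    · exact degree_monicOrtho G j ▸ Nat.cast_lt.2 j.lt_succ_self
  · intro i hi
    simp only [map_sub, map_smul, LinearMap.sub_apply, LinearMap.smul_apply, smul_eq_mul]
    rw [polyForm_monicOrtho_of_lt G hi (Nat.succ_le_succ hj)]
    rcases (Nat.lt_succ_iff.1 hi).eq_or_lt with rfl | hij
    · rw [polyForm_X_sub_C_mul_predistPolyLT_monicOrtho G hj]
      ring
    · rw [polyForm_X_sub_C_mul_predistPolyLT G hj (degree_monicOrtho G i ▸ Nat.cast_lt.2 hij),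
        polyForm_monicOrtho_of_lt G hij (by omega)]
      ring

theorem exists_christoffelDarboux_predistPoly [Nonempty V] {j : ℕ} (hj : j ≤ dNum G) :
    ∃ c : ℝ, c • ((X - C (lambda0 G)) * predistPolyLT G (j + 1)) =
      (predistPoly G j).eval (lambda0 G) • predistPoly G (j + 1) -
        (predistPoly G (j + 1)).eval (lambda0 G) • predistPoly G j := by
  refine ⟨(monicOrtho G j).eval (lambda0 G) * (monicOrtho G (j + 1)).eval (lambda0 G) /
    (polyForm G (monicOrtho G j) (monicOrtho G j) *
      polyForm G (monicOrtho G (j + 1)) (monicOrtho G (j + 1))) *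
    polyForm G (monicOrtho G j) (monicOrtho G j), ?_⟩
  rw [mul_smul, christoffelDarboux_monicOrtho G hj]
  simp only [predistPoly_eq_smul, eval_smul, smul_eq_mul, smul_sub, smul_smul]
  congr 2 <;> ring

/-! ### The Perron vector and the Hoffman polynomial -/

theorem isPerronVector_perronVector (hG : G.Connected) :
    IsPerronVector G (perronVector G hG) :=
  Classical.choose_spec (exists_isPerronVector G hG)

variable {G} {α : V → ℝ}

theorem IsPerronVector.dotProduct_self (hα : IsPerronVector G α) :
    α ⬝ᵥ α = Fintype.card V := by
  simp only [dotProduct, ← sq, hα.norm_sq]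

theorem IsPerronVector.exists_eq_smul (hα : IsPerronVector G α) (hG : G.Connected) {x : V → ℝ}
    (hx : (G.adjMatrix ℝ).mulVec x = lambda0 G • x) : ∃ c : ℝ, x = c • α := by
  have := hG.nonempty
  -- Subtract the largest multiple of `α` that leaves a nonnegative vector.
  obtain ⟨u₀, hu₀⟩ := Finite.exists_min fun u => x u / α u
  refine ⟨x u₀ / α u₀, sub_eq_zero.1 <|
    eq_zero_of_adjMatrix_mulVec_eq_smul hG.preconnected (μ := lambda0 G) ?_ (fun u => ?_)
      (u := u₀) ?_⟩
  · rw [Matrix.mulVec_sub, Matrix.mulVec_smul, hx, hα.eigen, smul_sub, smul_comm]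
  · exact sub_nonneg.2 ((le_div_iff₀ (hα.pos u)).1 (hu₀ u))
  · exact sub_eq_zero.2 (div_mul_cancel₀ _ (hα.pos u₀).ne').symm

theorem IsPerronVector.aeval_predistPolyLT (hα : IsPerronVector G α) (hG : G.Connected) :
    aeval (G.adjMatrix ℝ) (predistPolyLT G (dNum G + 1)) = Matrix.vecMulVec α α := by
  have := hG.nonempty
  set M := aeval (G.adjMatrix ℝ) (predistPolyLT G (dNum G + 1))
  have heigen : G.adjMatrix ℝ * M = lambda0 G • M := by
    have hCD := congrArg (aeval (G.adjMatrix ℝ)) (christoffelDarboux_monicOrtho G le_rfl)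
    rw [map_smul, map_sub, map_smul, map_smul, aeval_monicOrtho_dNum_succ,
      eval_lambda0_monicOrtho_dNum_succ, smul_zero, zero_smul, sub_zero,
      smul_eq_zero_iff_right (polyForm_monicOrtho_self_ne_zero G le_rfl), map_mul, map_sub, aeval_X,
      aeval_C, sub_mul, sub_eq_zero, ← Algebra.smul_def] at hCD
    exact hCD
  have htrace : M.trace = Fintype.card V := by
    have hone := polyForm_predistPolyLT G le_rfl (q := 1)
      (degree_one.trans_lt (Nat.cast_lt.2 (dNum G).succ_pos))
    rw [← mul_one (Fintype.card V : ℝ), ← eval_one (x := lambda0 G), ← hone, card_mul_polyForm,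
      map_one, mul_one]
  refine eq_vecMulVec_of_isSymm ?_ ?_ (fun j => hα.exists_eq_smul hG ?_) ?_
  · exact (M.conjTranspose_eq_transpose_of_trivial).symm.trans (isHermitian_aeval_adjMatrix G _)
  · rw [hα.dotProduct_self]
    exact card_ne_zero
  · exact funext fun i => congrFun (congrFun heigen i) j
  · rw [htrace, hα.dotProduct_self]

theorem diam_le_dNum (hG : G.Connected) : G.diam ≤ dNum G := by
  have := hG.nonempty
  obtain ⟨α, hα⟩ := exists_isPerronVector G hG
  obtain ⟨u, v, huv⟩ := G.exists_dist_eq_diam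
  by_contra! hlt
  have hzero : aeval (G.adjMatrix ℝ) (predistPolyLT G (dNum G + 1)) u v = 0 :=
    aeval_adjMatrix_apply_eq_zero_of_degree_lt <|
      (degree_predistPolyLT_lt G _).trans_le (Nat.cast_le.2 (by omega))
  rw [hα.aeval_predistPolyLT hG, Matrix.vecMulVec_apply] at hzero
  exact (mul_pos (hα.pos u) (hα.pos v)).ne' hzero

theorem IsPerronVector.exists_isRegularOfDegree [Nonempty V] (hα : IsPerronVector G α)
    (hone : α = 1) : ∃ k : ℕ, G.IsRegularOfDegree k := by
  have hdeg : ∀ u, (G.degree u : ℝ) = lambda0 G := by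
    intro u
    have h := congrFun hα.eigen u
    rw [SimpleGraph.adjMatrix_mulVec_apply] at h
    simpa [hone] using h
  obtain ⟨u₀⟩ := ‹Nonempty V›
  exact ⟨G.degree u₀, fun u => Nat.cast_injective ((hdeg u).trans (hdeg u₀).symm)⟩

theorem IsPerronVector.eq_one_of_subsingleton [Subsingleton V] (hα : IsPerronVector G α) :
    α = 1 := by
  funext u
  have hsq := hα.norm_sq
  rw [Fintype.sum_subsingleton _ u, Fintype.card_eq_one_iff.2 ⟨u, fun v => Subsingleton.elim v u⟩,
    Nat.cast_one] at hsq
  exact (pow_eq_one_iff_of_nonneg (hα.pos u).le two_ne_zero).1 hsq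

theorem IsPerronVector.eq_one_of_weightedDistMatrix_zero (hα : IsPerronVector G α)
    (hW : weightedDistMatrix G α 0 = 1) : α = 1 := by
  funext u
  have hsq := congrFun (congrFun hW u) u
  rw [weightedDistMatrix_apply, if_pos G.dist_self, Matrix.one_apply_eq, ← sq] at hsq
  exact (pow_eq_one_iff_of_nonneg (hα.pos u).le two_ne_zero).1 hsq

theorem IsPerronVector.weightedDistMatrix_ne_zero (hα : IsPerronVector G α) (hG : G.Connected)
    {j : ℕ} (hj : j ≤ G.diam) : weightedDistMatrix G α j ≠ 0 := by
  intro hzero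
  obtain ⟨u, v, huv⟩ := exists_dist_eq_of_le_diam hG hj
  have hentry := congrFun (congrFun hzero u) v
  rw [weightedDistMatrix_apply, if_pos huv] at hentry
  exact (mul_pos (hα.pos u) (hα.pos v)).ne' hentry

/-! ### Descending along the predistance polynomials -/

theorem aeval_adjMatrix_apply_of_dist_eq {f p : ℝ[X]} {j : ℕ}
    (hf : f.degree < (j : WithBot ℕ))
    (hsum : aeval (G.adjMatrix ℝ) (f + p) = ∑ i ∈ Finset.range (j + 1), weightedDistMatrix G α i)
    {u v : V} (huv : G.dist u v = j) : aeval (G.adjMatrix ℝ) p u v = α u * α v := by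
  have hentry := congrFun (congrFun hsum u) v
  rwa [map_add, Matrix.add_apply,
    aeval_adjMatrix_apply_eq_zero_of_degree_lt (huv.symm ▸ hf), zero_add,
    sum_weightedDistMatrix_apply, if_pos (by omega)] at hentry

theorem aeval_predistPolyLT_of_succ {m : ℕ}
    (hsum : aeval (G.adjMatrix ℝ) (predistPolyLT G (m + 1)) =
      ∑ i ∈ Finset.range (m + 1), weightedDistMatrix G α i)
    (hp : aeval (G.adjMatrix ℝ) (predistPoly G m) = weightedDistMatrix G α m) :
    aeval (G.adjMatrix ℝ) (predistPolyLT G m) =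
      ∑ i ∈ Finset.range m, weightedDistMatrix G α i := by
  rwa [predistPolyLT_succ, map_add, hp, Finset.sum_range_succ, add_left_inj] at hsum

theorem IsPerronVector.aeval_X_sub_C_mul_apply (hα : IsPerronVector G α) (hG : G.Connected)
    {p : ℝ[X]} {m : ℕ}
    (hp : aeval (G.adjMatrix ℝ) p = ∑ i ∈ Finset.range (m + 1), weightedDistMatrix G α i)
    {u v : V} (huv : G.dist u v < m) :
    aeval (G.adjMatrix ℝ) ((X - C (lambda0 G)) * p) u v = 0 := by
  have heigen := congrFun hα.eigen u
  rw [SimpleGraph.adjMatrix_mulVec_apply, Pi.smul_apply, smul_eq_mul] at heigen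
  rw [map_mul, map_sub, aeval_X, aeval_C, sub_mul, ← Algebra.smul_def, Matrix.sub_apply,
    Matrix.smul_apply, smul_eq_mul, hp, sum_weightedDistMatrix_apply, if_pos (by omega),
    SimpleGraph.adjMatrix_mul_apply, ← mul_assoc, ← heigen, Finset.sum_mul, sub_eq_zero]
  refine Finset.sum_congr rfl fun w hw => ?_
  have hadj : G.Adj w u := ((G.mem_neighborFinset u w).1 hw).symm
  have htri := hG.dist_triangle (u := w) (v := u) (w := v)
  rw [SimpleGraph.dist_eq_one_iff_adj.2 hadj] at htri
  rw [sum_weightedDistMatrix_apply, if_pos (by omega)]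

theorem IsPerronVector.aeval_predistPoly_of_succ (hα : IsPerronVector G α) (hG : G.Connected)
    {j : ℕ} (hj : j + 1 ≤ G.diam)
    (hsum : aeval (G.adjMatrix ℝ) (predistPolyLT G (j + 1)) =
      ∑ i ∈ Finset.range (j + 1), weightedDistMatrix G α i)
    (hsucc : aeval (G.adjMatrix ℝ) (predistPoly G (j + 1)) = weightedDistMatrix G α (j + 1)) :
    aeval (G.adjMatrix ℝ) (predistPoly G j) = weightedDistMatrix G α j := by
  have := hG.nonempty
  have hjd : j + 1 ≤ dNum G := hj.trans (diam_le_dNum hG)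
  have heval : (predistPoly G (j + 1)).eval (lambda0 G) ≠ 0 := by
    have hnorm := polyForm_predistPoly G hjd hjd
    rw [if_pos rfl] at hnorm
    rw [← hnorm, Ne, polyForm_self_eq_zero_iff, hsucc]
    exact hα.weightedDistMatrix_ne_zero hG hj
  obtain ⟨c, hCD⟩ := exists_christoffelDarboux_predistPoly G (Nat.le_of_succ_le hjd)
  ext u v
  rw [weightedDistMatrix_apply]
  rcases lt_trichotomy (G.dist u v) j with hlt | heq | hgt
  -- Here `(A - λ₀) (p_0 + ⋯ + p_j)(A)` and `p_{j+1}(A)` vanish, and Christoffel–Darboux leaves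
  -- only `p_j(A)`.
  · have hentry := congrFun (congrFun (congrArg (aeval (G.adjMatrix ℝ)) hCD) u) v
    rw [map_smul, map_sub, map_smul, map_smul, Matrix.smul_apply, Matrix.sub_apply,
      Matrix.smul_apply, Matrix.smul_apply, hα.aeval_X_sub_C_mul_apply hG hsum hlt, hsucc,
      weightedDistMatrix_apply, if_neg (by omega), smul_zero, smul_zero, zero_sub, eq_comm,
      neg_eq_zero] at hentry
    rw [if_neg hlt.ne, (smul_eq_zero_iff_right heval).1 hentry]
  · rw [predistPolyLT_succ] at hsum
    rw [if_pos heq, aeval_adjMatrix_apply_of_dist_eq (degree_predistPolyLT_lt G j) hsum heq]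
  · rw [if_neg hgt.ne', aeval_adjMatrix_apply_eq_zero_of_degree_lt
      ((degree_predistPoly_le G j).trans_lt (Nat.cast_lt.2 hgt))]

theorem IsPerronVector.aeval_predistPoly_of_le (hα : IsPerronVector G α) (hG : G.Connected)
    {m : ℕ} (hm : m ≤ G.diam)
    (hsum : aeval (G.adjMatrix ℝ) (predistPolyLT G (m + 1)) =
      ∑ i ∈ Finset.range (m + 1), weightedDistMatrix G α i)
    (hp : aeval (G.adjMatrix ℝ) (predistPoly G m) = weightedDistMatrix G α m) {i : ℕ}
    (hi : i ≤ m) : aeval (G.adjMatrix ℝ) (predistPoly G i) = weightedDistMatrix G α i := by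
  induction m with
  | zero => rwa [Nat.le_zero.1 hi]
  | succ m ih =>
    rcases hi.eq_or_lt with rfl | hi
    · exact hp
    · have hsum' := aeval_predistPolyLT_of_succ hsum hp
      exact ih (by omega) hsum' (hα.aeval_predistPoly_of_succ hG hm hsum' hp) (by omega)

/-! ### The numbers `δ*_i` -/

theorem norm_rho_sq (hG : G.Connected) (U : Finset V) :
    ‖rho G hG U‖ ^ 2 = ∑ v ∈ U, perronVector G hG v ^ 2 := by
  rw [EuclideanSpace.norm_sq_eq, ← Finset.sum_subset (Finset.subset_univ U)]
  · refine Finset.sum_congr rfl fun v hv => ?_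
    simp [rho, Finset.sum_apply, Pi.single_apply, hv]
  · intro v _ hv
    simp [rho, Finset.sum_apply, Pi.single_apply, hv]

theorem card_mul_deltaStar (hG : G.Connected) (i : ℕ) :
    Fintype.card V * deltaStar G hG i =
      (weightedDistMatrix G (perronVector G hG) i *
        weightedDistMatrix G (perronVector G hG) i).trace := by
  have := hG.nonempty
  rw [deltaStar, ← mul_assoc, mul_one_div_cancel card_ne_zero, one_mul, Matrix.trace]
  refine Finset.sum_congr rfl fun u _ => ?_
  rw [norm_rho_sq, sphere, Finset.sum_filter, Finset.mul_sum, Matrix.diag_apply, Matrix.mul_apply]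
  refine Finset.sum_congr rfl fun v _ => ?_
  rw [weightedDistMatrix_apply, weightedDistMatrix_apply, G.dist_comm (u := v)]
  split_ifs
  · ring
  · ring

/-- The equality case of `δ*_j ≤ ‖p‖²`. -/
theorem aeval_eq_weightedDistMatrix_of_deltaStar_eq (hG : G.Connected) {f p : ℝ[X]} {j : ℕ}
    (hf : f.degree < (j : WithBot ℕ))
    (hsum : aeval (G.adjMatrix ℝ) (f + p) =
      ∑ i ∈ Finset.range (j + 1), weightedDistMatrix G (perronVector G hG) i)
    (hδ : deltaStar G hG j = polyForm G p p) :
    aeval (G.adjMatrix ℝ) p = weightedDistMatrix G (perronVector G hG) j := by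
  have := hG.nonempty
  refine eq_of_trace_conjTranspose_mul_self_eq (fun u v huv => ?_) ?_
  · have hdist : G.dist u v = j := by
      by_contra h
      exact huv (if_neg h)
    rw [aeval_adjMatrix_apply_of_dist_eq hf hsum hdist, weightedDistMatrix_apply, if_pos hdist]
  · rw [(isHermitian_aeval_adjMatrix G p).eq, (isHermitian_weightedDistMatrix _ j).eq,
      ← card_mul_polyForm, ← card_mul_deltaStar, hδ]

theorem aeval_predistPolyGE_diam (hG : G.Connected)
    (hD : deltaStar G hG G.diam = (predistPolyGE G G.diam).eval (lambda0 G)) :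
    aeval (G.adjMatrix ℝ) (predistPolyGE G G.diam) =
      weightedDistMatrix G (perronVector G hG) G.diam := by
  have := hG.nonempty
  refine aeval_eq_weightedDistMatrix_of_deltaStar_eq hG (degree_predistPolyLT_lt G G.diam) ?_ ?_
  · rw [predistPolyLT_add_predistPolyGE G (Nat.le_succ_of_le (diam_le_dNum hG)),
      (isPerronVector_perronVector G hG).aeval_predistPolyLT hG, sum_weightedDistMatrix_diam hG]
  · rw [hD, predistPolyGE, polyForm_sum_predistPoly_self G fun i hi => (Finset.mem_Icc.1 hi).2]

theorem aeval_predistPolyLT_diam (hG : G.Connected)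
    (hD : deltaStar G hG G.diam = (predistPolyGE G G.diam).eval (lambda0 G)) :
    aeval (G.adjMatrix ℝ) (predistPolyLT G G.diam) =
      ∑ i ∈ Finset.range G.diam, weightedDistMatrix G (perronVector G hG) i := by
  have htotal := (isPerronVector_perronVector G hG).aeval_predistPolyLT hG
  rwa [← predistPolyLT_add_predistPolyGE G (Nat.le_succ_of_le (diam_le_dNum hG)), map_add,
    aeval_predistPolyGE_diam hG hD, ← sum_weightedDistMatrix_diam hG, Finset.sum_range_succ,
    add_left_inj] at htotal

theorem aeval_predistPoly_of_lt_diam (hG : G.Connected)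
    (hD : deltaStar G hG G.diam = (predistPolyGE G G.diam).eval (lambda0 G))
    (hD1 : deltaStar G hG (G.diam - 1) = (predistPoly G (G.diam - 1)).eval (lambda0 G))
    {i : ℕ} (hi : i < G.diam) :
    aeval (G.adjMatrix ℝ) (predistPoly G i) = weightedDistMatrix G (perronVector G hG) i := by
  have := hG.nonempty
  have hsum := aeval_predistPolyLT_diam hG hD
  have hle : G.diam ≤ dNum G := diam_le_dNum hG
  obtain ⟨m, hm⟩ := Nat.exists_eq_add_one_of_ne_zero (Nat.ne_zero_of_lt hi)
  rw [hm] at hsum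
  rw [hm, Nat.add_sub_cancel] at hD1
  have hp : aeval (G.adjMatrix ℝ) (predistPoly G m) =
      weightedDistMatrix G (perronVector G hG) m := by
    refine aeval_eq_weightedDistMatrix_of_deltaStar_eq hG (degree_predistPolyLT_lt G m) ?_ ?_
    · rw [← predistPolyLT_succ, hsum]
    · rw [hD1, polyForm_predistPoly G (by omega) (by omega), if_pos rfl]
  exact (isPerronVector_perronVector G hG).aeval_predistPoly_of_le hG (by omega) hsum hp
    (by omega)

theorem perronVector_eq_one (hG : G.Connected)
    (hD : deltaStar G hG G.diam = (predistPolyGE G G.diam).eval (lambda0 G))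
    (hD1 : deltaStar G hG (G.diam - 1) = (predistPoly G (G.diam - 1)).eval (lambda0 G)) :
    perronVector G hG = 1 := by
  have := hG.nonempty
  have hα := isPerronVector_perronVector G hG
  rcases Nat.eq_zero_or_pos G.diam with h0 | hpos
  · have : Subsingleton V :=
      ⟨fun u v => hG.dist_eq_zero_iff.1 (Nat.le_zero.1 (h0 ▸ dist_le_diam hG u v))⟩
    exact hα.eq_one_of_subsingleton
  · refine hα.eq_one_of_weightedDistMatrix_zero ?_
    rw [← aeval_predistPoly_of_lt_diam hG hD hD1 hpos, predistPoly_zero, map_one]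

end DistancePolynomial

open DistancePolynomial

theorem mainTheorem3 {V : Type*} [Fintype V] [DecidableEq V] (G : SimpleGraph V)
    [DecidableRel G.Adj] (hG : G.Connected)
    (hD : DistancePolynomial.deltaStar G hG G.diam =
      (DistancePolynomial.predistPolyGE G G.diam).eval (DistancePolynomial.lambda0 G))
    (hD1 : DistancePolynomial.deltaStar G hG (G.diam - 1) =
      (DistancePolynomial.predistPoly G (G.diam - 1)).eval (DistancePolynomial.lambda0 G)) :
    (∃ k : ℕ, G.IsRegularOfDegree k) ∧
      DistancePolynomial.IsPartiallyDistanceRegular G (G.diam - 1) ∧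
      DistancePolynomial.IsDistancePolynomial G := by
  have := hG.nonempty
  have hone := perronVector_eq_one hG hD hD1
  have hGE := aeval_predistPolyGE_diam hG hD
  rw [hone, weightedDistMatrix_one] at hGE
  have hlt : ∀ i < G.diam, aeval (G.adjMatrix ℝ) (predistPoly G i) = distMatrix G i :=
    fun i hi => by rw [aeval_predistPoly_of_lt_diam hG hD hD1 hi, hone, weightedDistMatrix_one]
  refine ⟨?_, ⟨Nat.sub_le _ _, fun i hi => ?_⟩, fun i hi => ?_⟩
  · exact (isPerronVector_perronVector G hG).exists_isRegularOfDegree hone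
  · rcases Nat.eq_zero_or_pos i with rfl | hpos
    · rw [predistPoly_zero, map_one, distMatrix_zero hG]
    · exact hlt i (by omega)
  · rcases hi.eq_or_lt with rfl | hi
    · exact ⟨_, hGE⟩
    · exact ⟨_, hlt i hi⟩
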